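/- An $f$-algebra is a real Riesz space (vector lattice) $A$ that is an associative algebra, not necessarily unital, such that $ab\ge 0$ whenever $a,b\ge 0$, and such that $a\wedge b=0$ and $c\ge 0$ imply $(ca)\wedge b=(ac)\wedge b=0$. It has the factorization property if it is Archimedean and for every $a\in A$ there exist $b,c\in A$ with $a=bc$. For a Riesz space $E$, let $E^{\sim}$ be its order dual, i.e. the Riesz space of all order bounded linear functionals on $E$, ordered by $f\le g$ iff $f(x)\le g(x)$ for all $x\ge 0$, and let $E^{\sim}_n\subseteq E^{\sim}$ be the set of order continuous functionals. Two elements $x,y$ of a Riesz space are disjoint, written $x\perp y$, if $|x|\wedge|y|=0$; two subsets $S,T$ are disjoint, written $S\perp T$, if $x\perp y$ for all $x\in S$, $y\in T$. For $f\in A^{\sim}$, $a\in A$ and $F\in (A^{\sim})^{\sim}$ define $f\cdot a\in A^{\sim}$ by $(f\cdot a)(b)=f(ab)$ for $b\in A$, and $F\cdot f\in A^{\sim}$ by $(F\cdot f)(a)=F(f\cdot a)$ for $a\in A$, and put $$R(f)=\{F\cdot f:\ F\in (A^{\sim})^{\sim}_n\}\subseteq A^{\sim}.$$ **Theorem.**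 Let $A$ be an $f$-algebra with the factorization property, and let $f,g\in A^{\sim}$. Then $f\perp g$ in $A^{\sim}$ if and only if $R(f)\perp R(g)$ in $A^{\sim}$. -/

import Mathlib

open Set Filter Topology

namespace RieszFAlg

universe u

/-! A Riesz space is a real vector space `E` with
`[AddCommGroup E] [Lattice E] [IsOrderedAddMonoid E] [Module ℝ E] [IsOrderedModule ℝ E]`. -/

section Riesz

variable {E : Type u} [AddCommGroup E] [Lattice E] [Module ℝ E]

/-- A linear functional is order bounded if it is bounded on every order interval. -/
def IsOrderBounded (f : E →ₗ[ℝ] ℝ) : Prop :=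
  ∀ a b : E, ∃ M : ℝ, ∀ x ∈ Icc a b, |f x| ≤ M

variable (E) in
/-- The vector space of all order bounded linear functionals on `E`. -/
def orderBoundedFunctionals : Submodule ℝ (E →ₗ[ℝ] ℝ) where
  carrier := {f | IsOrderBounded f}
  add_mem' := by
    intro f g hf hg a b
    obtain ⟨M, hM⟩ := hf a b
    obtain ⟨N, hN⟩ := hg a b
    refine ⟨M + N, fun x hx => ?_⟩
    exact (abs_add_le (f x) (g x)).trans (add_le_add (hM x hx) (hN x hx))
  zero_mem' := fun a b => ⟨0, fun x _ => by simp⟩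
  smul_mem' := by
    intro c f hf a b
    obtain ⟨M, hM⟩ := hf a b
    refine ⟨|c| * M, fun x hx => ?_⟩
    simp only [LinearMap.smul_apply, smul_eq_mul, abs_mul]
    exact mul_le_mul_of_nonneg_left (hM x hx) (abs_nonneg c)

variable (E) in
/-- The order dual `E~` of `E`: the order bounded linear functionals on `E`, which below is
ordered by `f ≤ g` iff `f x ≤ g x` for all `x ≥ 0`. -/
def RieszDual : Type u := ↥(orderBoundedFunctionals E)

noncomputable instance : AddCommGroup (RieszDual E) :=
  inferInstanceAs (AddCommGroup ↥(orderBoundedFunctionals E))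

noncomputable instance : Module ℝ (RieszDual E) :=
  inferInstanceAs (Module ℝ ↥(orderBoundedFunctionals E))

/-- The functional underlying an element of the order dual. -/
def RieszDual.toLin (f : RieszDual E) : E →ₗ[ℝ] ℝ := Subtype.val f

instance : CoeFun (RieszDual E) (fun _ => E → ℝ) := ⟨fun f => f.toLin⟩

theorem RieszDual.bdd (f : RieszDual E) : IsOrderBounded f.toLin := Subtype.property f

theorem RieszDual.add_apply (f g : RieszDual E) (x : E) : (f + g) x = f x + g x := rfl
theorem RieszDual.neg_apply (f : RieszDual E) (x : E) : (-f) x = -f x := rfl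
theorem RieszDual.sub_apply (f g : RieszDual E) (x : E) : (f - g) x = f x - g x := rfl
theorem RieszDual.zero_apply (x : E) : (0 : RieszDual E) x = 0 := rfl
theorem RieszDual.smul_apply (c : ℝ) (f : RieszDual E) (x : E) : (c • f) x = c * f x := rfl

theorem RieszDual.map_add (f : RieszDual E) (x y : E) : f (x + y) = f x + f y :=
  LinearMap.map_add f.toLin x y
theorem RieszDual.map_sub (f : RieszDual E) (x y : E) : f (x - y) = f x - f y :=
  LinearMap.map_sub f.toLin x y
theorem RieszDual.map_smul (f : RieszDual E) (c : ℝ) (x : E) : f (c • x) = c * f x :=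
  LinearMap.map_smul f.toLin c x
theorem RieszDual.map_zero (f : RieszDual E) : f (0 : E) = 0 :=
  LinearMap.map_zero f.toLin

theorem RieszDual.ext {f g : RieszDual E} (h : ∀ x, f x = g x) : f = g :=
  Subtype.ext (LinearMap.ext h)

variable [IsOrderedAddMonoid E]

instance : PartialOrder (RieszDual E) where
  le f g := ∀ x : E, 0 ≤ x → f x ≤ g x
  le_refl f x _ := le_rfl
  le_trans f g h h₁ h₂ x hx := (h₁ x hx).trans (h₂ x hx)
  le_antisymm f g h₁ h₂ := by
    apply RieszDual.ext
    intro x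
    have key : ∀ y : E, 0 ≤ y → f y = g y := fun y hy => le_antisymm (h₁ y hy) (h₂ y hy)
    have hx : x = x⁺ - x⁻ := (posPart_sub_negPart x).symm
    rw [hx, RieszDual.map_sub, RieszDual.map_sub, key _ (posPart_nonneg x),
      key _ (negPart_nonneg x)]

theorem RieszDual.le_iff {f g : RieszDual E} : f ≤ g ↔ ∀ x : E, 0 ≤ x → f x ≤ g x := Iff.rfl

/-- The value `f⁺(x) = sup {f y : 0 ≤ y ≤ x}` of the positive part of `f` at `x ≥ 0`. -/
noncomputable def conePos (f : RieszDual E) (x : E) : ℝ :=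
  sSup ((fun y => f y) '' Icc 0 x)

theorem bddAbove_cone (f : RieszDual E) (x : E) : BddAbove ((fun y => f y) '' Icc 0 x) := by
  obtain ⟨M, hM⟩ := f.bdd 0 x
  refine ⟨M, ?_⟩
  rintro _ ⟨y, hy, rfl⟩
  exact (le_abs_self _).trans (hM y hy)

theorem le_conePos (f : RieszDual E) {x y : E} (hy : 0 ≤ y) (hyx : y ≤ x) :
    f y ≤ conePos f x :=
  le_csSup (bddAbove_cone f x) ⟨y, ⟨hy, hyx⟩, rfl⟩

theorem conePos_le (f : RieszDual E) {x : E} (hx : 0 ≤ x) {M : ℝ}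
    (h : ∀ y, 0 ≤ y → y ≤ x → f y ≤ M) : conePos f x ≤ M := by
  refine csSup_le ⟨_, 0, ⟨le_rfl, hx⟩, rfl⟩ ?_
  rintro _ ⟨y, hy, rfl⟩
  exact h y hy.1 hy.2

theorem conePos_nonneg (f : RieszDual E) {x : E} (hx : 0 ≤ x) : 0 ≤ conePos f x := by
  have := le_conePos f (le_refl (0 : E)) hx
  rwa [RieszDual.map_zero] at this

theorem conePos_add (f : RieszDual E) {x y : E} (hx : 0 ≤ x) (hy : 0 ≤ y) :
    conePos f (x + y) = conePos f x + conePos f y := by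
  apply le_antisymm
  · refine conePos_le f (add_nonneg hx hy) fun z hz hzxy => ?_
    have h₁ : z - z ⊓ x ≤ y := by
      rw [sub_le_iff_le_add, add_comm, ← sub_le_iff_le_add]
      refine le_inf (sub_le_self z hy) ?_
      rwa [sub_le_iff_le_add]
    have h₂ : f z = f (z ⊓ x) + f (z - z ⊓ x) := by
      rw [← RieszDual.map_add]; congr 1; abel
    rw [h₂]
    exact add_le_add (le_conePos f (le_inf hz hx) inf_le_right)
      (le_conePos f (sub_nonneg.2 inf_le_left) h₁)
  · rw [← le_sub_iff_add_le]
    refine conePos_le f hx fun a ha hax => ?_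
    rw [le_sub_comm]
    refine conePos_le f hy fun b hb hby => ?_
    rw [le_sub_iff_add_le, add_comm, ← RieszDual.map_add]
    exact le_conePos f (add_nonneg ha hb) (add_le_add hax hby)

theorem conePos_zero (f : RieszDual E) : conePos f 0 = 0 := by
  have := conePos_add f (le_refl (0 : E)) le_rfl
  simp only [add_zero] at this
  linarith

theorem conePos_sub_eq (f : RieszDual E) {u v u' v' : E} (hu : 0 ≤ u) (hv : 0 ≤ v)
    (hu' : 0 ≤ u') (hv' : 0 ≤ v') (h : u - v = u' - v') :
    conePos f u - conePos f v = conePos f u' - conePos f v' := by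
  have h' : u + v' = u' + v := by
    rw [sub_eq_sub_iff_add_eq_add] at h; exact h
  have h₁ := conePos_add f hu hv'
  have h₂ := conePos_add f hu' hv
  rw [h'] at h₁
  linarith

variable [IsOrderedModule ℝ E]

theorem conePos_smul_le (f : RieszDual E) {c : ℝ} (hc : 0 < c) {x : E} (hx : 0 ≤ x) :
    conePos f (c • x) ≤ c * conePos f x := by
  refine conePos_le f (smul_nonneg hc.le hx) fun y hy hyx => ?_
  have h₁ : c⁻¹ • y ≤ x := by
    have := smul_le_smul_of_nonneg_left hyx (inv_nonneg.2 hc.le)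
    rwa [smul_smul, inv_mul_cancel₀ hc.ne', one_smul] at this
  have h₂ := le_conePos f (smul_nonneg (inv_nonneg.2 hc.le) hy) h₁
  rw [RieszDual.map_smul] at h₂
  rwa [inv_mul_le_iff₀ hc] at h₂

theorem conePos_smul (f : RieszDual E) {c : ℝ} (hc : 0 ≤ c) {x : E} (hx : 0 ≤ x) :
    conePos f (c • x) = c * conePos f x := by
  rcases hc.eq_or_lt with rfl | hc
  · simp [conePos_zero]
  apply le_antisymm (conePos_smul_le f hc hx)
  have := conePos_smul_le f (inv_pos.2 hc) (smul_nonneg hc.le hx)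
  rw [smul_smul, inv_mul_cancel₀ hc.ne', one_smul] at this
  rwa [le_inv_mul_iff₀ hc] at this

/-- The positive part of `f` as a linear functional. -/
noncomputable def posLin (f : RieszDual E) : E →ₗ[ℝ] ℝ where
  toFun x := conePos f x⁺ - conePos f x⁻
  map_add' x y := by
    have h : (x + y)⁺ - (x + y)⁻ = (x⁺ + y⁺) - (x⁻ + y⁻) := by
      rw [posPart_sub_negPart, add_sub_add_comm, posPart_sub_negPart, posPart_sub_negPart]
    rw [conePos_sub_eq f (posPart_nonneg _) (negPart_nonneg _)
      (add_nonneg (posPart_nonneg _) (posPart_nonneg _))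
      (add_nonneg (negPart_nonneg _) (negPart_nonneg _)) h,
      conePos_add f (posPart_nonneg _) (posPart_nonneg _),
      conePos_add f (negPart_nonneg _) (negPart_nonneg _)]
    ring
  map_smul' c x := by
    simp only [RingHom.id_apply, smul_eq_mul]
    rcases le_total 0 c with hc | hc
    · have h : (c • x)⁺ - (c • x)⁻ = c • x⁺ - c • x⁻ := by
        rw [posPart_sub_negPart, ← smul_sub, posPart_sub_negPart]
      rw [conePos_sub_eq f (posPart_nonneg _) (negPart_nonneg _)
        (smul_nonneg hc (posPart_nonneg _)) (smul_nonneg hc (negPart_nonneg _)) h,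
        conePos_smul f hc (posPart_nonneg _), conePos_smul f hc (negPart_nonneg _)]
      ring
    · have hc' : 0 ≤ -c := neg_nonneg.2 hc
      have h : (c • x)⁺ - (c • x)⁻ = (-c) • x⁻ - (-c) • x⁺ := by
        rw [posPart_sub_negPart, ← smul_sub, ← neg_sub x⁺ x⁻, posPart_sub_negPart, smul_neg,
          neg_smul, neg_neg]
      rw [conePos_sub_eq f (posPart_nonneg _) (negPart_nonneg _)
        (smul_nonneg hc' (negPart_nonneg _)) (smul_nonneg hc' (posPart_nonneg _)) h,
        conePos_smul f hc' (posPart_nonneg _), conePos_smul f hc' (negPart_nonneg _)]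
      ring

theorem posLin_of_nonneg (f : RieszDual E) {x : E} (hx : 0 ≤ x) : posLin f x = conePos f x := by
  change conePos f x⁺ - conePos f x⁻ = conePos f x
  rw [posPart_of_nonneg hx, negPart_of_nonneg hx, conePos_zero, sub_zero]

theorem posLin_mono (f : RieszDual E) {x y : E} (hxy : x ≤ y) : posLin f x ≤ posLin f y := by
  have h := conePos_nonneg f (sub_nonneg.2 hxy)
  rw [← posLin_of_nonneg f (sub_nonneg.2 hxy), LinearMap.map_sub] at h
  linarith

/-- The positive part `f⁺ = f ∨ 0` in the order dual. -/
noncomputable def dualPos (f : RieszDual E) : RieszDual E :=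
  ⟨posLin f, fun a b => ⟨max |posLin f a| |posLin f b|, fun _ hx =>
    abs_le_max_abs_abs (posLin_mono f hx.1) (posLin_mono f hx.2)⟩⟩

theorem dualPos_apply (f : RieszDual E) {x : E} (hx : 0 ≤ x) : dualPos f x = conePos f x :=
  posLin_of_nonneg f hx

theorem dualPos_nonneg (f : RieszDual E) : 0 ≤ dualPos f := fun x hx => by
  rw [dualPos_apply f hx]; exact conePos_nonneg f hx

theorem le_dualPos (f : RieszDual E) : f ≤ dualPos f := fun x hx => by
  rw [dualPos_apply f hx]; exact le_conePos f hx le_rfl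

theorem dualPos_le {f h : RieszDual E} (hf : f ≤ h) (h0 : 0 ≤ h) : dualPos f ≤ h := fun x hx => by
  rw [dualPos_apply f hx]
  refine conePos_le f hx fun y hy hyx => (hf y hy).trans ?_
  have h₁ := h0 (x - y) (sub_nonneg.2 hyx)
  rw [RieszDual.zero_apply, RieszDual.map_sub] at h₁
  linarith

instance : IsOrderedAddMonoid (RieszDual E) where
  add_le_add_left f g h k x hx := by
    have := h x hx
    rw [RieszDual.add_apply, RieszDual.add_apply]
    linarith

instance : IsOrderedModule ℝ (RieszDual E) where
  smul_le_smul_of_nonneg_left _ hc _ _ h x hx := mul_le_mul_of_nonneg_left (h x hx) hc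
  smul_le_smul_of_nonneg_right _ hf _ _ h x hx := mul_le_mul_of_nonneg_right h (hf x hx)

/-- The order dual is a Riesz space; `f ∨ g = g + (f - g)⁺` and `f ∧ g = f - (f - g)⁺`. -/
noncomputable instance : Lattice (RieszDual E) where
  sup f g := g + dualPos (f - g)
  inf f g := f - dualPos (f - g)
  le_sup_left f g := sub_le_iff_le_add'.1 (le_dualPos (f - g))
  le_sup_right f g := le_add_of_nonneg_right (dualPos_nonneg (f - g))
  sup_le f g h hf hg := by
    rw [add_comm, ← le_sub_iff_add_le]
    exact dualPos_le (sub_le_sub_right hf g) (sub_nonneg.2 hg)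
  inf_le_left f g := sub_le_self f (dualPos_nonneg (f - g))
  inf_le_right f g := sub_le_comm.1 (le_dualPos (f - g))
  le_inf h f g hf hg := by
    rw [le_sub_comm]
    exact dualPos_le (sub_le_sub_left hg f) (sub_nonneg.2 hf)

end Riesz

section Order

variable {E : Type u} [AddCommGroup E] [Lattice E]

/-- Disjointness `x ⊥ y` in a Riesz space. -/
def RieszDisjoint (x y : E) : Prop := |x| ⊓ |y| = 0

/-- Two sets are disjoint in the Riesz space sense if each element of one is disjoint from
each element of the other. -/
def SetsRieszDisjoint (S T : Set E) : Prop := ∀ x ∈ S, ∀ y ∈ T, RieszDisjoint x y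

variable (E) in
/-- Archimedean Riesz spaces. (The class `Archimedean` in the library is a different
condition, suited to linear orders.) -/
def IsArchimedeanRiesz : Prop := ∀ x y : E, 0 ≤ x → (∀ n : ℕ, n • x ≤ y) → x = 0

/-- Order convergence of a net `x` to `0`: it is dominated by a net decreasing to `0`. -/
def OrderTendstoZero {ι : Type*} [Preorder ι] (x : ι → E) : Prop :=
  ∃ y : ι → E, Antitone y ∧ IsGLB (range y) 0 ∧ ∀ i, |x i| ≤ y i

/-- A linear functional is order continuous if it maps nets that are order convergent to `0`
to nets converging to `0`. Index sets in the universe of `E` suffice: a violation by an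
arbitrary net yields one by a net indexed by a downward directed subset of `E`. -/
def IsOrderContinuous [Module ℝ E] (F : E →ₗ[ℝ] ℝ) : Prop :=
  ∀ (ι : Type u) [Preorder ι] [Nonempty ι] [IsDirectedOrder ι] (x : ι → E),
    OrderTendstoZero x → Tendsto (fun i => F (x i)) atTop (𝓝 0)

variable (E) in
/-- The order continuous part `E~ₙ` of the order dual `E~`. -/
def orderContinuousDual [Module ℝ E] : Submodule ℝ (RieszDual E) where
  carrier := {F | IsOrderContinuous F.toLin}
  add_mem' := by
    intro F G hF hG ι _ _ _ x hx
    have h := (hF ι x hx).add (hG ι x hx)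
    rw [add_zero] at h
    exact h
  zero_mem' := by
    intro ι _ _ _ x hx
    exact tendsto_const_nhds
  smul_mem' := by
    intro c F hF ι _ _ _ x hx
    have h := (hF ι x hx).const_mul c
    rw [mul_zero] at h
    exact h

end Order

section FAlgebra

/-- An `f`-algebra: a Riesz space which is an associative algebra (not necessarily unital) such
that products of positive elements are positive, and `a ∧ b = 0`, `c ≥ 0` imply
`(c a) ∧ b = (a c) ∧ b = 0`. -/
class IsFAlgebra (A : Type u) [NonUnitalRing A] [Lattice A] [Module ℝ A] : Prop
    extends IsOrderedAddMonoid A, IsOrderedModule ℝ A, IsScalarTower ℝ A A,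
      SMulCommClass ℝ A A where
  mul_nonneg' : ∀ a b : A, 0 ≤ a → 0 ≤ b → 0 ≤ a * b
  mul_left_inf : ∀ a b c : A, a ⊓ b = 0 → 0 ≤ c → (c * a) ⊓ b = 0
  mul_right_inf : ∀ a b c : A, a ⊓ b = 0 → 0 ≤ c → (a * c) ⊓ b = 0

/-- The factorization property: `A` is Archimedean and each element is a product of two. -/
def HasFactorizationProperty (A : Type u) [NonUnitalRing A] [Lattice A] : Prop :=
  IsArchimedeanRiesz A ∧ ∀ a : A, ∃ b c : A, a = b * c

variable {A : Type u} [NonUnitalRing A] [Lattice A] [Module ℝ A] [IsFAlgebra A]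

theorem mul_mono_left {a b c : A} (ha : 0 ≤ a) (h : b ≤ c) : a * b ≤ a * c := by
  have := IsFAlgebra.mul_nonneg' a (c - b) ha (sub_nonneg.2 h)
  rwa [mul_sub, sub_nonneg] at this

theorem mul_mono_right {a b c : A} (ha : 0 ≤ a) (h : b ≤ c) : b * a ≤ c * a := by
  have := IsFAlgebra.mul_nonneg' (c - b) a (sub_nonneg.2 h) ha
  rwa [sub_mul, sub_nonneg] at this

/-- The map `A × A~ → A~`, `(f · a)(b) = f (a b)`. -/
noncomputable def dualAct (f : RieszDual A) (a : A) : RieszDual A :=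
  ⟨f.toLin ∘ₗ LinearMap.mulLeft ℝ a, by
    intro b c
    obtain ⟨M, hM⟩ := f.bdd (a⁺ * b) (a⁺ * c)
    obtain ⟨N, hN⟩ := f.bdd (a⁻ * b) (a⁻ * c)
    refine ⟨M + N, fun x hx => ?_⟩
    have h₁ := hM (a⁺ * x) ⟨mul_mono_left (posPart_nonneg a) hx.1,
      mul_mono_left (posPart_nonneg a) hx.2⟩
    have h₂ := hN (a⁻ * x) ⟨mul_mono_left (negPart_nonneg a) hx.1,
      mul_mono_left (negPart_nonneg a) hx.2⟩
    have h₃ : a * x = a⁺ * x - a⁻ * x := by rw [← sub_mul, posPart_sub_negPart]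
    change |f (a * x)| ≤ M + N
    rw [h₃, RieszDual.map_sub]
    exact (abs_sub (f (a⁺ * x)) (f (a⁻ * x))).trans (add_le_add h₁ h₂)⟩

theorem dualAct_apply (f : RieszDual A) (a b : A) : dualAct f a b = f (a * b) := rfl

/-- The map `a ↦ f · a` is linear. -/
noncomputable def dualActLin (f : RieszDual A) : A →ₗ[ℝ] RieszDual A where
  toFun a := dualAct f a
  map_add' a b := RieszDual.ext fun x => by
    rw [RieszDual.add_apply, dualAct_apply, dualAct_apply, dualAct_apply, add_mul,
      RieszDual.map_add]
  map_smul' c a := RieszDual.ext fun x => by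
    rw [RingHom.id_apply, RieszDual.smul_apply, dualAct_apply, dualAct_apply, smul_mul_assoc,
      RieszDual.map_smul]

theorem dualAct_mono {f : RieszDual A} (hf : 0 ≤ f) {a b : A} (h : a ≤ b) :
    dualAct f a ≤ dualAct f b := fun x hx => by
  have := hf (b * x - a * x) (sub_nonneg.2 (mul_mono_right hx h))
  rw [RieszDual.zero_apply, RieszDual.map_sub] at this
  rw [dualAct_apply, dualAct_apply]
  linarith

/-- The map `(A~)~ × A~ → A~`, `(F · f)(a) = F (f · a)`. -/
noncomputable def bidualAct (F : RieszDual (RieszDual A)) (f : RieszDual A) : RieszDual A :=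
  ⟨F.toLin ∘ₗ dualActLin f, by
    intro b c
    obtain ⟨M, hM⟩ := F.bdd (dualAct f⁺ b) (dualAct f⁺ c)
    obtain ⟨N, hN⟩ := F.bdd (dualAct f⁻ b) (dualAct f⁻ c)
    refine ⟨M + N, fun x hx => ?_⟩
    have h₁ := hM (dualAct f⁺ x) ⟨dualAct_mono (posPart_nonneg f) hx.1,
      dualAct_mono (posPart_nonneg f) hx.2⟩
    have h₂ := hN (dualAct f⁻ x) ⟨dualAct_mono (negPart_nonneg f) hx.1,
      dualAct_mono (negPart_nonneg f) hx.2⟩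
    have h₃ : dualAct f x = dualAct f⁺ x - dualAct f⁻ x := RieszDual.ext fun y => by
      rw [RieszDual.sub_apply, dualAct_apply, dualAct_apply, dualAct_apply,
        ← RieszDual.sub_apply, posPart_sub_negPart]
    change |F (dualAct f x)| ≤ M + N
    rw [h₃, RieszDual.map_sub]
    exact (abs_sub (F (dualAct f⁺ x)) (F (dualAct f⁻ x))).trans (add_le_add h₁ h₂)⟩

theorem bidualAct_apply (F : RieszDual (RieszDual A)) (f : RieszDual A) (a : A) :
    bidualAct F f a = F (dualAct f a) := rfl

/-- `R(f) = {F · f : F ∈ (A~)~ₙ}`. -/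
def imageSet (f : RieszDual A) : Set (RieszDual A) :=
  {h | ∃ F ∈ orderContinuousDual (RieszDual A), h = bidualAct F f}

end FAlgebra

end RieszFAlg

/-! By the Riesz–Kantorovich formula, `f ⊥ g` provides for each `a ≥ 0` elements `0 ≤ bₙ ≤ a` with
`|f| bₙ` and `|g| (a - bₙ)` at most `4⁻ⁿ`. The `f`-algebra inequality `b x ≤ b x² + b`, applied to
`2⁻ⁿ x` in place of `x`, bounds `|f| (bₙ x)` by a multiple of `2⁻ⁿ`. Hence `∑ |f| · bₙ` converges
pointwise, `|f| · bₙ` is order null, and `|F · f| bₙ → 0` for order continuous `F`, which gives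
`F · f ⊥ g`.

It follows that for order continuous `F ≥ 0` the map `f ↦ F · f` is a lattice homomorphism, so
`F · (|f| ∧ |g|) ≤ |F · f| ∧ |F · g|`. When `R(f) ⊥ R(g)`, evaluation at `c ≥ 0` in place of `F`
shows that `|f| ∧ |g|` vanishes at all products `b c` of positive elements. Every element of `A`
lies below such a product, so `|f| ∧ |g| = 0`. -/

namespace RieszFAlg

universe u v

section Disjointness

variable {E : Type u} [AddCommGroup E] [Lattice E]

theorem RieszDisjoint.symm {x y : E} (h : RieszDisjoint x y) : RieszDisjoint y x := by
  rwa [RieszDisjoint, inf_comm]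

variable [IsOrderedAddMonoid E]

theorem rieszDisjoint_posPart_negPart (x : E) : RieszDisjoint x⁺ x⁻ := by
  rw [RieszDisjoint, abs_of_nonneg (posPart_nonneg x), abs_of_nonneg (negPart_nonneg x),
    posPart_inf_negPart_eq_zero]

theorem RieszDisjoint.abs_sub_eq_abs_add_abs {x y : E} (h : RieszDisjoint x y) :
    |(|x| - |y|)| = |x| + |y| := by
  rw [← sup_sub_inf_eq_abs_sub, inf_comm, h, sub_zero, ← inf_add_sup |x| |y|, h, zero_add, sup_comm]

theorem abs_map_of_disjoint {F : Type v} [AddCommGroup F] [Lattice F] [IsOrderedAddMonoid F]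
    (T : E →+ F) (hpos : ∀ x, 0 ≤ x → 0 ≤ T x)
    (hT : ∀ x y, RieszDisjoint x y → RieszDisjoint (T x) (T y)) (x : E) : |T x| = T |x| := by
  have h := (hT _ _ (rieszDisjoint_posPart_negPart x)).abs_sub_eq_abs_add_abs
  rwa [abs_of_nonneg (hpos _ (posPart_nonneg x)), abs_of_nonneg (hpos _ (negPart_nonneg x)),
    ← map_sub, ← map_add, posPart_sub_negPart, posPart_add_negPart] at h

theorem le_of_le_add_of_inf_eq_zero {w p q : E} (hq : 0 ≤ q) (h : w ⊓ p = 0) (hle : w ≤ p + q) :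
    w ≤ q := by
  have h' : w - q ≤ w ⊓ p := le_inf (sub_le_self w hq) (sub_le_iff_le_add.2 hle)
  rwa [h, sub_nonpos] at h'

end Disjointness

theorem IsOrderContinuous.tendsto_zero {E : Type u} [AddCommGroup E] [Lattice E] [Module ℝ E]
    {F : E →ₗ[ℝ] ℝ} (hF : IsOrderContinuous F) {ι : Type} [Preorder ι] [Nonempty ι]
    [IsDirectedOrder ι] {x : ι → E} (hx : OrderTendstoZero x) :
    Tendsto (fun i => F (x i)) atTop (𝓝 0) := by
  obtain ⟨y, hy, hglb, hxy⟩ := hx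
  -- `IsOrderContinuous` tests nets indexed in the universe of `E`.
  have hx' : OrderTendstoZero fun i : ULift.{u} ι => x i.down :=
    ⟨fun i => y i.down, fun _ _ hij => hy hij, by
      rwa [← ULift.down_surjective.range_comp y] at hglb, fun i => hxy i.down⟩
  have : IsDirectedOrder (ULift.{u} ι) :=
    ⟨fun i j => (exists_ge_ge i.down j.down).elim fun k hk => ⟨⟨k⟩, hk⟩⟩
  exact (hF _ _ hx').comp (ULift.orderIso.{u} (α := ι)).symm.tendsto_atTop

section RieszDual

variable {E : Type u} [AddCommGroup E] [Lattice E] [Module ℝ E]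

theorem RieszDual.sum_apply {ι : Type*} (s : Finset ι) (u : ι → RieszDual E) (x : E) :
    (∑ i ∈ s, u i) x = ∑ i ∈ s, u i x :=
  map_sum (⟨⟨fun f : RieszDual E => f x, rfl⟩, fun _ _ => rfl⟩ : RieszDual E →+ ℝ) u s

variable [IsOrderedAddMonoid E]

theorem isOrderBounded_of_nonneg {L : E →ₗ[ℝ] ℝ} (hL : ∀ x, 0 ≤ x → 0 ≤ L x) :
    IsOrderBounded L := by
  have hmono : Monotone L := fun x y hxy => by
    simpa only [LinearMap.map_sub, sub_nonneg] using hL (y - x) (sub_nonneg.2 hxy)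
  exact fun a b => ⟨max |L a| |L b|, fun x hx => abs_le_max_abs_abs (hmono hx.1) (hmono hx.2)⟩

namespace RieszDual

theorem apply_nonneg {f : RieszDual E} (hf : 0 ≤ f) {x : E} (hx : 0 ≤ x) : 0 ≤ f x :=
  hf x hx

theorem monotone {f : RieszDual E} (hf : 0 ≤ f) : Monotone f := fun x y hxy => by
  simpa only [map_sub, sub_nonneg] using apply_nonneg hf (sub_nonneg.2 hxy)

theorem exists_tendsto_of_nonneg {ι : Type*} {l : Filter ι} [l.NeBot] {y : ι → RieszDual E}
    (hpos : ∀ i, 0 ≤ y i) (hy : ∀ x, 0 ≤ x → ∃ c, Tendsto (fun i => y i x) l (𝓝 c)) :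
    ∃ φ : RieszDual E, 0 ≤ φ ∧ ∀ x, Tendsto (fun i => y i x) l (𝓝 (φ x)) := by
  have hconv : ∀ x, ∃ c, Tendsto (fun i => y i x) l (𝓝 c) := fun x => by
    obtain ⟨c, hc⟩ := hy x⁺ (posPart_nonneg x)
    obtain ⟨d, hd⟩ := hy x⁻ (negPart_nonneg x)
    refine ⟨c - d, (hc.sub hd).congr fun i => ?_⟩
    rw [← map_sub, posPart_sub_negPart]
  choose φ hφ using hconv
  let L : E →ₗ[ℝ] ℝ := linearMapOfTendsto φ (fun i => (y i).toLin) (tendsto_pi_nhds.2 hφ)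
  have hL : ∀ x, 0 ≤ x → 0 ≤ L x := fun x hx =>
    ge_of_tendsto' (hφ x) fun i => apply_nonneg (hpos i) hx
  exact ⟨⟨L, isOrderBounded_of_nonneg hL⟩, hL, hφ⟩

theorem tendsto_apply_of_isGLB_zero {ι : Type*} [Preorder ι] [Nonempty ι] [IsDirectedOrder ι]
    {y : ι → RieszDual E} (hy : Antitone y) (h0 : IsGLB (range y) 0) (x : E) :
    Tendsto (fun i => y i x) atTop (𝓝 0) := by
  have hpos : ∀ i, 0 ≤ y i := fun i => h0.1 ⟨i, rfl⟩
  have hanti : ∀ x, 0 ≤ x → Antitone fun i => y i x := fun x hx i j hij => hy hij x hx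
  obtain ⟨φ, hφ0, hφ⟩ := exists_tendsto_of_nonneg (l := atTop) hpos fun x hx =>
    ⟨_, tendsto_atTop_ciInf (hanti x hx)
      ⟨0, forall_mem_range.2 fun i => apply_nonneg (hpos i) hx⟩⟩
  have hφ_le : φ ≤ 0 := h0.2 <| forall_mem_range.2 fun i x hx => (hanti x hx).le_of_tendsto (hφ x) i
  simpa only [le_antisymm hφ_le hφ0, zero_apply] using hφ x

theorem abs_apply_le_of_nonneg {f : RieszDual E} (hf : 0 ≤ f) (x : E) : |f x| ≤ f |x| := by
  refine abs_le'.2 ⟨monotone hf (le_abs_self x), ?_⟩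
  simpa only [LinearMap.map_neg] using monotone hf (neg_le_abs x)

variable [IsOrderedModule ℝ E]

theorem isLUB_sup_apply (f g : RieszDual E) {a : E} (ha : 0 ≤ a) :
    IsLUB ((fun y => f y + g (a - y)) '' Icc 0 a) ((f ⊔ g) a) := by
  refine ⟨forall_mem_image.2 fun y hy => ?_, fun M hM => ?_⟩
  · have hf : f y ≤ (f ⊔ g) y := (le_sup_left : f ≤ f ⊔ g) y hy.1
    have hg : g (a - y) ≤ (f ⊔ g) (a - y) := (le_sup_right : g ≤ f ⊔ g) _ (sub_nonneg.2 hy.2)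
    rw [map_sub (f ⊔ g)] at hg
    linarith
  · have hsup : (f ⊔ g) a = g a + conePos (f - g) a := by
      rw [← dualPos_apply _ ha]
      rfl
    have hcone : conePos (f - g) a ≤ M - g a := conePos_le _ ha fun y hy hya => by
      have hy' : f y + g (a - y) ≤ M := hM ⟨y, ⟨hy, hya⟩, rfl⟩
      rw [map_sub] at hy'
      rw [sub_apply]
      linarith
    linarith

theorem isGLB_inf_apply (f g : RieszDual E) {a : E} (ha : 0 ≤ a) :
    IsGLB ((fun y => f y + g (a - y)) '' Icc 0 a) ((f ⊓ g) a) := by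
  refine ⟨forall_mem_image.2 fun y hy => ?_, fun M hM => ?_⟩
  · have hf : (f ⊓ g) y ≤ f y := (inf_le_left : f ⊓ g ≤ f) y hy.1
    have hg : (f ⊓ g) (a - y) ≤ g (a - y) := (inf_le_right : f ⊓ g ≤ g) _ (sub_nonneg.2 hy.2)
    rw [map_sub (f ⊓ g)] at hg
    linarith
  · have hadd : (f ⊓ g) a + (f ⊔ g) a = f a + g a := by
      rw [← add_apply, inf_add_sup, add_apply]
    have hsup : (f ⊔ g) a ≤ f a + g a - M := (isLUB_sup_apply f g ha).2 <|
      forall_mem_image.2 fun y hy => by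
        have hy' : M ≤ f (a - y) + g (a - (a - y)) :=
          hM ⟨a - y, ⟨sub_nonneg.2 hy.2, sub_le_self a hy.1⟩, rfl⟩
        rw [sub_sub_cancel, map_sub] at hy'
        rw [map_sub]
        linarith
    linarith

theorem inf_eq_zero_iff {f g : RieszDual E} (hf : 0 ≤ f) (hg : 0 ≤ g) :
    f ⊓ g = 0 ↔ ∀ a, 0 ≤ a → ∀ ε > 0, ∃ b ∈ Icc 0 a, f b + g (a - b) < ε := by
  refine ⟨fun h a ha ε hε => ?_, fun h => le_antisymm (fun a ha => ?_) (le_inf hf hg)⟩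
  · have hglb := isGLB_inf_apply f g ha
    rw [h] at hglb
    exact exists_mem_image.1 ((isGLB_lt_iff hglb).1 hε)
  · refine le_of_forall_pos_lt_add fun ε hε => ?_
    obtain ⟨b, hb, hlt⟩ := h a ha ε hε
    rw [zero_apply, zero_add]
    exact ((isGLB_inf_apply f g ha).1 ⟨b, hb, rfl⟩).trans_lt hlt

theorem abs_apply_le (f : RieszDual E) (x : E) : |f x| ≤ |f| |x| := by
  have key : ∀ y, 0 ≤ y → |f y| ≤ |f| y := fun y hy =>
    abs_le'.2 ⟨le_abs_self f y hy, neg_le_abs f y hy⟩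
  calc |f x| = |f x⁺ - f x⁻| := by rw [← map_sub, posPart_sub_negPart]
    _ ≤ |f x⁺| + |f x⁻| := abs_sub _ _
    _ ≤ |f| x⁺ + |f| x⁻ := add_le_add (key _ (posPart_nonneg x)) (key _ (negPart_nonneg x))
    _ = |f| |x| := by rw [← map_add, posPart_add_negPart]

theorem isLUB_abs_apply (f : RieszDual E) {b : E} (hb : 0 ≤ b) :
    IsLUB ((fun z => f z) '' {z | |z| ≤ b}) (|f| b) := by
  refine ⟨forall_mem_image.2 fun z hz => ?_, fun M hM => ?_⟩
  · exact (le_abs_self _).trans ((abs_apply_le f z).trans (monotone (abs_nonneg f) hz))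
  · refine (isLUB_sup_apply f (-f) hb).2 <| forall_mem_image.2 fun y hy => ?_
    have hz : |y - (b - y)| ≤ b := abs_le'.2
      ⟨(sub_le_self y (sub_nonneg.2 hy.2)).trans hy.2,
        by rw [neg_sub]; exact (sub_le_self _ hy.1).trans (sub_le_self b hy.1)⟩
    have hM' : f (y - (b - y)) ≤ M := hM ⟨_, hz, rfl⟩
    rwa [neg_apply, ← sub_eq_add_neg, ← map_sub]

theorem orderTendstoZero_of_summable {u v : ℕ → RieszDual E} (hpos : ∀ n, 0 ≤ u n)
    (hu : ∀ x, 0 ≤ x → Summable fun n => u n x) (hv : ∀ n, |v n| ≤ u n) : OrderTendstoZero v := by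
  have hpartial : Monotone fun N => ∑ n ∈ Finset.range N, u n :=
    monotone_nat_of_le_succ fun N => by
      rw [Finset.sum_range_succ]
      exact le_add_of_nonneg_right (hpos N)
  obtain ⟨S, -, hS⟩ := exists_tendsto_of_nonneg (l := atTop)
    (fun N => Finset.sum_nonneg fun n (_ : n ∈ Finset.range N) => hpos n) fun x hx =>
      ⟨_, by simpa only [sum_apply] using (hu x hx).hasSum.tendsto_sum_nat⟩
  have hle : ∀ N, ∑ n ∈ Finset.range N, u n ≤ S := fun N x hx =>
    Monotone.ge_of_tendsto (fun i j hij => hpartial hij x hx) (hS x) N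
  refine ⟨fun N => S - ∑ n ∈ Finset.range N, u n, fun i j hij => sub_le_sub_left (hpartial hij) S,
    ⟨forall_mem_range.2 fun N => sub_nonneg.2 (hle N), fun h hh x hx => ?_⟩, fun N => ?_⟩
  · have htail : Tendsto (fun N => (S - ∑ n ∈ Finset.range N, u n) x) atTop (𝓝 0) := by
      simpa only [sub_apply, sub_self] using (hS x).const_sub (S x)
    exact ge_of_tendsto' htail fun N => hh ⟨N, rfl⟩ x hx
  · refine (hv N).trans (le_sub_iff_add_le.2 ?_)
    rw [add_comm, ← Finset.sum_range_succ]
    exact hle (N + 1)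

/-- Evaluation at `a`, the image of `a` under the canonical map of `E` into its order bidual. If `E`
is an `f`-algebra, then `eval a · f` is the functional `b ↦ f (b a)`, an element of `R(f)`. -/
def eval (a : E) : RieszDual (RieszDual E) :=
  ⟨⟨⟨fun f => f a, fun _ _ => rfl⟩, fun _ _ => rfl⟩, fun g h => by
    refine ⟨|g a| + (h - g) |a|, fun f hf => ?_⟩
    calc |f a| = |g a + (f - g) a| := by rw [← add_apply, add_sub_cancel]
      _ ≤ |g a| + |(f - g) a| := abs_add_le _ _
      _ ≤ |g a| + (f - g) |a| := by
        gcongr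
        exact abs_apply_le_of_nonneg (sub_nonneg.2 hf.1) a
      _ ≤ |g a| + (h - g) |a| := by
        gcongr
        exact sub_le_sub_right hf.2 g _ (abs_nonneg a)⟩

theorem eval_nonneg {a : E} (ha : 0 ≤ a) : 0 ≤ eval a := fun _ hf => apply_nonneg hf ha

theorem eval_mem_orderContinuousDual (a : E) : eval a ∈ orderContinuousDual (RieszDual E) := by
  rintro ι _ _ _ x ⟨y, hy, hglb, hxy⟩
  exact squeeze_zero_norm (fun i => (abs_apply_le (x i) a).trans (hxy i _ (abs_nonneg a)))
    (tendsto_apply_of_isGLB_zero hy hglb |a|)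

end RieszDual

end RieszDual

section FAlgebra

variable {A : Type u} [NonUnitalRing A] [Lattice A] [Module ℝ A] [IsFAlgebra A]

theorem abs_mul_le (a b : A) : |a * b| ≤ |a| * |b| := by
  have key : ∀ y, 0 ≤ y → |a * y| ≤ |a| * y := fun y hy =>
    abs_le'.2 ⟨mul_mono_right hy (le_abs_self a), by
      rw [← neg_mul]
      exact mul_mono_right hy (neg_le_abs a)⟩
  calc |a * b| = |a * b⁺ + -(a * b⁻)| := by
        rw [← sub_eq_add_neg, ← mul_sub, posPart_sub_negPart]
    _ ≤ |a * b⁺| + |a * b⁻| := (abs_add_le _ _).trans_eq (by rw [abs_neg])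
    _ ≤ |a| * b⁺ + |a| * b⁻ := add_le_add (key _ (posPart_nonneg b)) (key _ (negPart_nonneg b))
    _ = |a| * |b| := by rw [← mul_add, posPart_add_negPart]

theorem mul_le_mul_mul_add {b x : A} (hb : 0 ≤ b) (hx : 0 ≤ x) : b * x ≤ b * x * x + b := by
  set p := b * x - b with hp
  have hneg : p⁻ * x ≤ b := by
    have hdisj : p⁻ ⊓ p⁺ = 0 := by rw [inf_comm, posPart_inf_negPart_eq_zero]
    refine le_of_le_add_of_inf_eq_zero hb (IsFAlgebra.mul_right_inf _ _ _ hdisj hx) ?_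
    have hpb : p⁻ ≤ b := by
      rw [negPart_def, hp, neg_sub]
      exact sup_le (sub_le_self b (IsFAlgebra.mul_nonneg' _ _ hb hx)) hb
    calc p⁻ * x ≤ b * x := mul_mono_right hx hpb
      _ = p + b := (sub_add_cancel _ _).symm
      _ ≤ p⁺ + b := by gcongr; exact le_posPart p
  have hpos : 0 ≤ p⁺ * x := IsFAlgebra.mul_nonneg' _ _ (posPart_nonneg p) hx
  rw [← sub_nonneg]
  calc 0 ≤ p⁺ * x + (b - p⁻ * x) := add_nonneg hpos (sub_nonneg.2 hneg)
    _ = (p⁺ - p⁻) * x + b := by rw [sub_mul]; abel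
    _ = b * x * x + b - b * x := by rw [posPart_sub_negPart, hp, sub_mul]; abel

theorem RieszDual.mul_apply_mul_le {f : RieszDual A} (hf : 0 ≤ f) {b x : A} (hb : 0 ≤ b)
    (hx : 0 ≤ x) {t : ℝ} (ht : 0 ≤ t) : t * f (b * x) ≤ t ^ 2 * f (b * x * x) + f b := by
  have h := monotone hf (mul_le_mul_mul_add hb (smul_nonneg ht hx))
  simpa only [mul_smul_comm, smul_mul_assoc, map_add, map_smul, ← mul_assoc, ← sq] using h

theorem dualAct_nonneg {f : RieszDual A} (hf : 0 ≤ f) {a : A} (ha : 0 ≤ a) : 0 ≤ dualAct f a :=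
  fun _ hx => RieszDual.apply_nonneg hf (IsFAlgebra.mul_nonneg' _ _ ha hx)

theorem abs_dualAct_le (f : RieszDual A) {z b : A} (h : |z| ≤ b) :
    |dualAct f z| ≤ dualAct |f| b := by
  have key : ∀ x, 0 ≤ x → |f (z * x)| ≤ |f| (b * x) := fun x hx =>
    calc |f (z * x)| ≤ |f| |z * x| := RieszDual.abs_apply_le f _
      _ ≤ |f| (b * x) := RieszDual.monotone (abs_nonneg f) <| (abs_mul_le z x).trans <| by
        rw [abs_of_nonneg hx]
        exact mul_mono_right hx h
  exact abs_le'.2 ⟨fun x hx => (le_abs_self _).trans (key x hx),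
    fun x hx => (neg_le_abs _).trans (key x hx)⟩

theorem summable_dualAct_apply {ι : Type*} {f : RieszDual A} (hf : 0 ≤ f) {a : A} {b : ι → A}
    (hb : ∀ i, b i ∈ Icc 0 a) {r : ι → ℝ} (hr : Summable r) (hr0 : ∀ i, 0 < r i)
    (hfb : ∀ i, f (b i) ≤ r i ^ 2) {x : A} (hx : 0 ≤ x) :
    Summable fun i => dualAct f (b i) x := by
  refine Summable.of_nonneg_of_le
    (fun i => RieszDual.apply_nonneg (dualAct_nonneg hf (hb i).1) hx) (fun i => ?_)
    (hr.mul_right (f (a * x * x) + 1))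
  have hba : f (b i * x * x) ≤ f (a * x * x) :=
    RieszDual.monotone hf (mul_mono_right hx (mul_mono_right hx (hb i).2))
  refine le_of_mul_le_mul_left ?_ (hr0 i)
  calc r i * f (b i * x) ≤ r i ^ 2 * f (b i * x * x) + f (b i) :=
        RieszDual.mul_apply_mul_le hf (hb i).1 hx (hr0 i).le
    _ ≤ r i ^ 2 * f (a * x * x) + r i ^ 2 := by gcongr; exact hfb i
    _ = r i * (r i * (f (a * x * x) + 1)) := by ring

theorem tendsto_abs_bidualAct_apply {F : RieszDual (RieszDual A)}
    (hF : F ∈ orderContinuousDual (RieszDual A)) {f : RieszDual A} {a : A} {b : ℕ → A}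
    (hb : ∀ n, b n ∈ Icc 0 a) {r : ℕ → ℝ} (hr : Summable r) (hr0 : ∀ n, 0 < r n)
    (hfb : ∀ n, |f| (b n) ≤ r n ^ 2) :
    Tendsto (fun n => |bidualAct F f| (b n)) atTop (𝓝 0) := by
  have hz : ∀ n, ∃ z, |z| ≤ b n ∧ |bidualAct F f| (b n) - r n < bidualAct F f z := fun n =>
    exists_mem_image.1 <| (lt_isLUB_iff (RieszDual.isLUB_abs_apply _ (hb n).1)).1
      (sub_lt_self _ (hr0 n))
  choose z hzb hlt using hz
  have hnull : OrderTendstoZero fun n => dualAct f (z n) :=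
    RieszDual.orderTendstoZero_of_summable (fun n => dualAct_nonneg (abs_nonneg f) (hb n).1)
      (fun _ => summable_dualAct_apply (abs_nonneg f) hb hr hr0 hfb)
      (fun n => abs_dualAct_le f (hzb n))
  have hlim : Tendsto (fun n => F (dualAct f (z n)) + r n) atTop (𝓝 0) := by
    simpa only [add_zero] using
      (IsOrderContinuous.tendsto_zero hF hnull).add hr.tendsto_atTop_zero
  exact squeeze_zero (fun n => RieszDual.apply_nonneg (abs_nonneg _) (hb n).1)
    (fun n => (sub_lt_iff_lt_add.1 (hlt n)).le) hlim

theorem RieszDisjoint.bidualAct_left {f g : RieszDual A} (h : RieszDisjoint f g)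
    {F : RieszDual (RieszDual A)} (hF : F ∈ orderContinuousDual (RieszDual A)) :
    RieszDisjoint (bidualAct F f) g := by
  refine (RieszDual.inf_eq_zero_iff (abs_nonneg _) (abs_nonneg g)).2 fun a ha ε hε => ?_
  let r : ℕ → ℝ := fun n => (1 / 2) ^ n
  have hr : Summable r := summable_geometric_two
  have hr0 : ∀ n, 0 < r n := fun n => by positivity
  choose b hb hlt using fun n =>
    (RieszDual.inf_eq_zero_iff (abs_nonneg f) (abs_nonneg g)).1 h a ha (r n ^ 2) (pow_pos (hr0 n) 2)
  have hf0 : ∀ n, 0 ≤ |f| (b n) := fun n => RieszDual.apply_nonneg (abs_nonneg f) (hb n).1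
  have hg0 : ∀ n, 0 ≤ |g| (a - b n) := fun n =>
    RieszDual.apply_nonneg (abs_nonneg g) (sub_nonneg.2 (hb n).2)
  have hflim : Tendsto (fun n => |bidualAct F f| (b n)) atTop (𝓝 0) :=
    tendsto_abs_bidualAct_apply hF hb hr hr0 fun n => by linarith [hlt n, hg0 n]
  have hr2 : Tendsto (fun n => r n ^ 2) atTop (𝓝 0) := by
    simpa only [zero_pow two_ne_zero] using hr.tendsto_atTop_zero.pow 2
  have hglim : Tendsto (fun n => |g| (a - b n)) atTop (𝓝 0) :=
    squeeze_zero hg0 (fun n => by linarith only [hlt n, hf0 n]) hr2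
  have hlim := hflim.add hglim
  rw [add_zero] at hlim
  obtain ⟨n, hn⟩ := (hlim.eventually_lt_const hε).exists
  exact ⟨b n, hb n, hn⟩

theorem RieszDisjoint.bidualAct {f g : RieszDual A} (h : RieszDisjoint f g)
    {F G : RieszDual (RieszDual A)} (hF : F ∈ orderContinuousDual (RieszDual A))
    (hG : G ∈ orderContinuousDual (RieszDual A)) :
    RieszDisjoint (bidualAct F f) (bidualAct G g) :=
  ((h.bidualAct_left hF).symm.bidualAct_left hG).symm

theorem bidualAct_nonneg {F : RieszDual (RieszDual A)} (hF : 0 ≤ F) {f : RieszDual A}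
    (hf : 0 ≤ f) : 0 ≤ bidualAct F f :=
  fun _ ha => RieszDual.apply_nonneg hF (dualAct_nonneg hf ha)

theorem bidualAct_add (F : RieszDual (RieszDual A)) (f g : RieszDual A) :
    bidualAct F (f + g) = bidualAct F f + bidualAct F g :=
  RieszDual.ext fun a => RieszDual.map_add F (dualAct f a) (dualAct g a)

theorem bidualAct_mono {F : RieszDual (RieszDual A)} (hF : 0 ≤ F) :
    Monotone (bidualAct F) := fun f g hfg => by
  rw [← add_sub_cancel f g, bidualAct_add]
  exact le_add_of_nonneg_right (bidualAct_nonneg hF (sub_nonneg.2 hfg))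

theorem abs_bidualAct {F : RieszDual (RieszDual A)} (hF0 : 0 ≤ F)
    (hF : F ∈ orderContinuousDual (RieszDual A)) (f : RieszDual A) :
    |bidualAct F f| = bidualAct F |f| :=
  abs_map_of_disjoint (AddMonoidHom.mk' (bidualAct F) (bidualAct_add F))
    (fun _ => bidualAct_nonneg hF0) (fun _ _ h => h.bidualAct hF hF) f

theorem bidualAct_abs_inf_abs_nonpos {f g : RieszDual A}
    (h : SetsRieszDisjoint (imageSet f) (imageSet g)) {F : RieszDual (RieszDual A)} (hF0 : 0 ≤ F)
    (hF : F ∈ orderContinuousDual (RieszDual A)) : bidualAct F (|f| ⊓ |g|) ≤ 0 :=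
  calc bidualAct F (|f| ⊓ |g|) ≤ bidualAct F |f| ⊓ bidualAct F |g| :=
        (bidualAct_mono hF0).map_inf_le _ _
    _ = |bidualAct F f| ⊓ |bidualAct F g| := by rw [abs_bidualAct hF0 hF, abs_bidualAct hF0 hF]
    _ = 0 := h _ ⟨F, hF, rfl⟩ _ ⟨F, hF, rfl⟩

theorem eq_zero_of_apply_mul_nonpos (hA : ∀ a : A, ∃ b c : A, a ≤ b * c) {h : RieszDual A}
    (h0 : 0 ≤ h) (hmul : ∀ b c : A, 0 ≤ b → 0 ≤ c → h (b * c) ≤ 0) : h = 0 := by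
  refine le_antisymm (fun a _ => ?_) h0
  obtain ⟨b, c, habc⟩ := hA a
  have hle : a ≤ |b| * |c| := habc.trans ((le_abs_self _).trans (abs_mul_le b c))
  exact (RieszDual.monotone h0 hle).trans (hmul _ _ (abs_nonneg b) (abs_nonneg c))

end FAlgebra

end RieszFAlg

open RieszFAlg in
theorem theorem2p5_general {A : Type*} [NonUnitalRing A] [Lattice A] [Module ℝ A] [IsFAlgebra A]
    (hA : ∀ a : A, ∃ b c : A, a ≤ b * c) (f g : RieszDual A) :
    RieszDisjoint f g ↔ SetsRieszDisjoint (imageSet f) (imageSet g) := by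
  constructor
  · rintro h _ ⟨F, hF, rfl⟩ _ ⟨G, hG, rfl⟩
    exact h.bidualAct hF hG
  · intro h
    refine eq_zero_of_apply_mul_nonpos hA (le_inf (abs_nonneg f) (abs_nonneg g))
      fun b c hb hc => ?_
    exact bidualAct_abs_inf_abs_nonpos h (RieszDual.eval_nonneg hc)
      (RieszDual.eval_mem_orderContinuousDual c) b hb

theorem theorem2p5 {A : Type*} [NonUnitalRing A] [Lattice A] [Module ℝ A]
    [RieszFAlg.IsFAlgebra A] (hA : RieszFAlg.HasFactorizationProperty A)
    (f g : RieszFAlg.RieszDual A) :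
    RieszFAlg.RieszDisjoint f g ↔
      RieszFAlg.SetsRieszDisjoint (RieszFAlg.imageSet f) (RieszFAlg.imageSet g) :=
  theorem2p5_general (fun a => (hA.2 a).imp fun _ h => h.imp fun _ => Eq.le) f g
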